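/- For integers $k>1$ and $q>2$, let $S_k(q)$ be the $\mathbb{Q}$-linear span of the real numbers $$\frac{\zeta(k,a/q)}{\pi^k},\qquad 1\le a<q,\ \gcd(a,q)=1,$$ where $\zeta(k,x)=\sum_{n=0}^{\infty}\frac{1}{(n+x)^k}$ $(0<x\le 1)$ is the Hurwitz zeta function, and let $\varphi$ be Euler's totient function. Let $k>1$ be an odd integer. Then there exists an integer $q_0>2$ (depending only on $k$) such that $$\dim_{\mathbb{Q}} S_k(q)\ \ge\ \frac{\varphi(q)}{2}+1$$ for every integer $q>2$ with $\gcd(q,q_0)=1$. -/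

import Mathlib

/-- For `x ∈ (0, 1]` and an integer `k > 1`, Mathlib's Hurwitz zeta function (with parameter in
`ℝ / ℤ`) takes the value `∑ n ≥ 0, 1 / (n + x) ^ k`, the sum of a convergent series of reals. -/
theorem hasSum_hurwitzZeta_series {k : ℕ} (hk : 1 < k) {x : ℝ} (hx : x ∈ Set.Ioc (0 : ℝ) 1) :
    HasSum (fun n : ℕ => (((1 / ((n : ℝ) + x) ^ k : ℝ)) : ℂ))
      (HurwitzZeta.hurwitzZeta (x : UnitAddCircle) (k : ℂ)) := by
  have h := HurwitzZeta.hasSum_hurwitzZeta_of_one_lt_re (a := x) ⟨hx.1.le, hx.2⟩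
    (s := (k : ℂ)) (by simpa using hk)
  simpa [Complex.cpow_natCast] using h

/-- `S_k(q)`: the `ℚ`-linear span, inside `ℂ`, of the (real) numbers `ζ(k, a/q) / π ^ k`
with `1 ≤ a < q` and `gcd(a, q) = 1`. -/
noncomputable def normalizedHurwitzSpace (k q : ℕ) : Submodule ℚ ℂ :=
  Submodule.span ℚ
    {z : ℂ | ∃ a : ℕ, 1 ≤ a ∧ a < q ∧ Nat.Coprime a q ∧
      z = HurwitzZeta.hurwitzZeta (((a : ℝ) / (q : ℝ) : ℝ) : UnitAddCircle) (k : ℂ) /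
        (Real.pi : ℂ) ^ k}

open Complex HurwitzZeta ZMod Polynomial

/-! Let `V_q` be the span of the odd parts `(ζ(k, a/q) - ζ(k, 1 - a/q)) / π ^ k`. Fourier inversion
on `ZMod q` and the Bernoulli values of sine zeta functions at odd `k` put `V_q` inside `i·ℚ(ζ_q)`,
with Galois acting by multiplication on `a`. A rational relation therefore survives every unit
translation. Pairing the translates with an odd character `χ` factors out `L(k, χ) ≠ 0`, so only the
relations forced by oddness remain and `dim V_q = φ(q)/2`.

The space `S_k(q)` also contains `ζ(k) / π ^ k`, so the bound holds unless this number lies in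
`V_q`. If it lies in `V_r` and in `V_q` with `q`, `r` coprime, then it lies in `i·(ℚ(ζ_q) ∩ ℚ(ζ_r))
= i·ℚ`, which is absurd for a nonzero real. So any exceptional `r` serves as `q₀`. -/

/-- A rational polynomial relation at a primitive root of unity holds at all its conjugates. -/
lemma IsPrimitiveRoot.aeval_pow_eq_zero {n b : ℕ} {ζ : ℂ} (hζ : IsPrimitiveRoot ζ n) (hn : 0 < n)
    (hb : b.Coprime n) {P : ℚ[X]} (hP : aeval ζ P = 0) : aeval (ζ ^ b) P = 0 := by
  have h1 : minpoly ℚ (ζ ^ b) = minpoly ℚ ζ := by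
    rw [← cyclotomic_eq_minpoly_rat hζ hn,
      ← cyclotomic_eq_minpoly_rat (hζ.pow_of_coprime b hb) hn]
  rw [← minpoly.dvd_iff, h1]
  exact minpoly.dvd _ _ hP

/-! ### Odd Hurwitz values as cyclotomic numbers -/

lemma ZMod.stdAddChar_eq_pow_val {N : ℕ} [NeZero N] (a : ZMod N) :
    (stdAddChar a : ℂ) = stdAddChar (1 : ZMod N) ^ a.val := by
  rw [← AddChar.map_nsmul_eq_pow, nsmul_eq_mul, mul_one, natCast_zmod_val]

lemma ZMod.isPrimitiveRoot_stdAddChar_one (N : ℕ) [NeZero N] :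
    IsPrimitiveRoot (stdAddChar (1 : ZMod N) : ℂ) N := by
  have := Complex.isPrimitiveRoot_exp N (NeZero.ne N)
  convert this using 1
  have h := stdAddChar_coe (N := N) 1
  simpa using h

/-- This is `LFunction_dft` applied to the inverse Fourier transform of the indicator function of
`a`. -/
lemma ZMod.hurwitzZeta_toAddCircle_eq {N : ℕ} [NeZero N] (a : ZMod N) {s : ℂ} (hs : s ≠ 1) :
    hurwitzZeta (toAddCircle a) s =
      (N : ℂ) ^ s * (N : ℂ)⁻¹ * ∑ j : ZMod N, stdAddChar (j * a) * expZeta (toAddCircle (-j)) s := by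
  have hN : (N : ℂ) ≠ 0 := NeZero.ne _
  have h := LFunction_dft (N := N) (ZMod.dft.symm (Pi.single a (1 : ℂ))) (Or.inr hs)
  rw [LinearEquiv.apply_symm_apply, LFunction] at h
  simp only [Pi.single_apply, ite_mul, one_mul, zero_mul, Finset.sum_ite_eq', Finset.mem_univ,
    if_true] at h
  have h2 : hurwitzZeta (toAddCircle a) s = (N : ℂ) ^ s * ((N : ℂ) ^ (-s) *
      hurwitzZeta (toAddCircle a) s) := by
    rw [← mul_assoc, ← cpow_add _ _ hN, add_neg_cancel, cpow_zero, one_mul]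
  rw [h2, h, mul_assoc, Finset.mul_sum (a := (N : ℂ)⁻¹)]
  congr 1
  refine Finset.sum_congr rfl fun j _ ↦ ?_
  rw [ZMod.invDFT_apply]
  simp [Pi.single_apply, mul_comm, mul_assoc]

/-- The difference `ζ(s, a/N) - ζ(s, 1 - a/N)` in terms of sine zeta functions. -/
lemma ZMod.hurwitzZeta_sub_neg_eq {N : ℕ} [NeZero N] (a : ZMod N) {s : ℂ} (hs : s ≠ 1) :
    hurwitzZeta (toAddCircle a) s - hurwitzZeta (toAddCircle (-a)) s =
      -2 * I * ((N : ℂ) ^ s * (N : ℂ)⁻¹) *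
        ∑ j : ZMod N, stdAddChar (j * a) * sinZeta (toAddCircle j) s := by
  have h1 : ∑ j : ZMod N, stdAddChar (j * -a) * expZeta (toAddCircle (-j)) s =
      ∑ j : ZMod N, stdAddChar (j * a) * expZeta (toAddCircle j) s := by
    rw [← Equiv.sum_comp (Equiv.neg (ZMod N))]
    simp
  rw [hurwitzZeta_toAddCircle_eq a hs, hurwitzZeta_toAddCircle_eq (-a) hs, h1, ← mul_sub,
    ← Finset.sum_sub_distrib, mul_comm (-2 * I), mul_assoc (_ * _) (-2 * I), Finset.mul_sum (a := -2 * I)]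
  congr 1
  refine Finset.sum_congr rfl fun j _ ↦ ?_
  rw [map_neg, sinZeta_eq]
  field_simp [I_ne_zero]
  ring

/-- The normalized odd part of the Hurwitz zeta function at the residue class `a`. -/
noncomputable def oddHurwitz (k N : ℕ) [NeZero N] (a : ZMod N) : ℂ :=
  (hurwitzZeta (toAddCircle a) k - hurwitzZeta (toAddCircle (-a)) k) / (Real.pi : ℂ) ^ k

/-- For odd `k > 1`, the normalized odd part is `I` times an element of the cyclotomic field, and
its values at different residue classes are given by one polynomial. -/
lemma exists_oddHurwitz_eq_aeval {k : ℕ} (hk : 1 < k) (hodd : Odd k) (N : ℕ) [NeZero N] :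
    ∃ P : ℚ[X], ∀ a : ZMod N, oddHurwitz k N a = I * aeval (stdAddChar a : ℂ) P := by
  obtain ⟨m, rfl⟩ := hodd
  -- The Bernoulli value of `sinZeta` at `j / N`, stripped of `π ^ k`, times the Fourier prefactor
  -- stripped of `I`.
  let c : ZMod N → ℚ := fun j ↦ (-2 * ((N : ℚ) ^ (2 * m + 1) * (N : ℚ)⁻¹)) *
    ((-1) ^ (m + 1) * 2 ^ (2 * m + 1) / 2 / (2 * m + 1).factorial *
      (Polynomial.bernoulli (2 * m + 1)).eval ((j.val : ℚ) / N))
  refine ⟨∑ j : ZMod N, C (c j) * X ^ j.val, fun a ↦ ?_⟩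
  have hs : ((2 * m + 1 : ℕ) : ℂ) ≠ 1 := by
    norm_cast; omega
  have hpi : (Real.pi : ℂ) ≠ 0 := by exact_mod_cast Real.pi_ne_zero
  rw [oddHurwitz, hurwitzZeta_sub_neg_eq a hs, div_eq_iff (pow_ne_zero _ hpi), map_sum,
    Finset.mul_sum, Finset.mul_sum, Finset.sum_mul]
  refine Finset.sum_congr rfl fun j _ ↦ ?_
  have hj : (j.val / N : ℝ) ∈ Set.Icc (0 : ℝ) 1 := ⟨by positivity,
    (div_le_one (Nat.cast_pos.mpr <| NeZero.pos _)).mpr <| Nat.cast_le.mpr (val_lt j).le⟩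
  have h1 := sinZeta_two_mul_nat_add_one (k := m) (by omega) hj
  have h2 : (stdAddChar (j * a) : ℂ) = stdAddChar a ^ j.val := by
    rw [← AddChar.map_nsmul_eq_pow, nsmul_eq_mul, natCast_zmod_val]
  have h3 : (((Polynomial.bernoulli (2 * m + 1)).map (algebraMap ℚ ℂ)).eval (((j.val / N : ℝ)) : ℂ)) =
      (((Polynomial.bernoulli (2 * m + 1)).eval ((j.val : ℚ) / N) : ℚ) : ℂ) := by
    have : (((j.val / N : ℝ)) : ℂ) = algebraMap ℚ ℂ ((j.val : ℚ) / N) := by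
      rw [eq_ratCast]; push_cast; rfl
    rw [this, eval_map_algebraMap, aeval_algebraMap_apply]
    simp
  rw [h3] at h1
  rw [toAddCircle_apply, Nat.cast_add, Nat.cast_mul, Nat.cast_two, Nat.cast_one, h1, h2]
  have h4 : (N : ℂ) ^ (2 * (m : ℂ) + 1) = (N : ℂ) ^ (2 * m + 1) := by
    rw [← cpow_natCast]; push_cast; rfl
  rw [h4]
  simp only [map_mul, aeval_C, map_pow, aeval_X, c, eq_ratCast]
  push_cast
  ring

/-! ### Character sums and rational relations -/

lemma MulChar.sum_mul_eq_sum_units {N : ℕ} [NeZero N] (χ : DirichletCharacter ℂ N)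
    (g : ZMod N → ℂ) : ∑ b : ZMod N, χ b * g b = ∑ u : (ZMod N)ˣ, χ u * g u := by
  symm
  refine Fintype.sum_of_injective _ Units.val_injective _ _ (fun b hb ↦ ?_) fun _ ↦ rfl
  rw [χ.map_nonunit fun h ↦ hb ⟨h.unit, rfl⟩, zero_mul]

lemma DirichletCharacter.sum_units_mul_hurwitzZeta {N : ℕ} [NeZero N]
    (χ : DirichletCharacter ℂ N) (s : ℂ) :
    ∑ u : (ZMod N)ˣ, χ u * hurwitzZeta (toAddCircle (u : ZMod N)) s =
      (N : ℂ) ^ s * χ.LFunction s := by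
  have hN : (N : ℂ) ≠ 0 := NeZero.ne _
  rw [DirichletCharacter.LFunction, ZMod.LFunction, ← mul_assoc, ← cpow_add _ _ hN,
    add_neg_cancel, cpow_zero, one_mul, MulChar.sum_mul_eq_sum_units χ]

/-- For odd `χ` both halves contribute equally, giving `2 N ^ k L(k, χ) / π ^ k`; the L-value is
nonzero because `k > 1`. -/
lemma sum_char_mul_oddHurwitz_ne_zero {k : ℕ} (hk : 1 < k) {N : ℕ} [NeZero N]
    {χ : DirichletCharacter ℂ N} (hχ : χ.Odd) :
    ∑ u : (ZMod N)ˣ, χ u * oddHurwitz k N u ≠ 0 := by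
  have hN : (N : ℂ) ≠ 0 := NeZero.ne _
  have hpi : (Real.pi : ℂ) ≠ 0 := by exact_mod_cast Real.pi_ne_zero
  have h1 : ∑ u : (ZMod N)ˣ, χ u * hurwitzZeta (toAddCircle (-u : ZMod N)) k =
      -∑ u : (ZMod N)ˣ, χ u * hurwitzZeta (toAddCircle (u : ZMod N)) k := by
    rw [← Equiv.sum_comp (Equiv.neg (ZMod N)ˣ), ← Finset.sum_neg_distrib]
    refine Finset.sum_congr rfl fun u _ ↦ ?_
    simp only [Equiv.neg_apply, Units.val_neg, hχ.eval_neg, neg_neg, neg_mul]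
  have h2 : ∑ u : (ZMod N)ˣ, χ u * oddHurwitz k N u =
      2 * ((N : ℂ) ^ (k : ℂ) * χ.LFunction k) / (Real.pi : ℂ) ^ k := by
    simp only [oddHurwitz, ← mul_div_assoc, ← Finset.sum_div, mul_sub, Finset.sum_sub_distrib]
    rw [h1, DirichletCharacter.sum_units_mul_hurwitzZeta]
    ring
  have hk' : 1 < (k : ℂ).re := by simpa using hk
  rw [h2, DirichletCharacter.LFunction_eq_LSeries χ hk']
  have := DirichletCharacter.LSeries_ne_zero_of_one_lt_re χ hk'
  have h3 : (N : ℂ) ^ (k : ℂ) ≠ 0 := by simp [hN]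
  exact div_ne_zero (mul_ne_zero two_ne_zero (mul_ne_zero h3 this)) (pow_ne_zero _ hpi)

/-- A function on the units all of whose character sums vanish is zero. -/
lemma eq_zero_of_forall_sum_char_eq_zero {N : ℕ} [NeZero N] {d : (ZMod N)ˣ → ℂ}
    (h : ∀ χ : DirichletCharacter ℂ N, ∑ u : (ZMod N)ˣ, d u * χ (u⁻¹ : (ZMod N)ˣ) = 0) : d = 0 := by
  ext v
  have h1 : ∑ χ : DirichletCharacter ℂ N, (∑ u : (ZMod N)ˣ, d u * χ (u⁻¹ : (ZMod N)ˣ)) * χ v = 0 :=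
    Finset.sum_eq_zero fun χ _ ↦ by rw [h, zero_mul]
  simp only [Finset.sum_mul] at h1
  rw [Finset.sum_comm] at h1
  simp only [mul_assoc, ← Finset.mul_sum, ← ZMod.inv_coe_unit,
    DirichletCharacter.sum_char_inv_mul_char_eq ℂ (Units.isUnit _), Units.val_inj] at h1
  simpa [NeZero.ne] using h1

/-- A rational relation between the odd parts is preserved by multiplying the classes by a unit. -/
lemma sum_mul_oddHurwitz_mul_eq_zero {k : ℕ} (hk : 1 < k) (hodd : Odd k) {N : ℕ} [NeZero N]
    {c : (ZMod N)ˣ → ℚ} (h : ∑ u, (c u : ℂ) * oddHurwitz k N u = 0) (v : (ZMod N)ˣ) :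
    ∑ u, (c u : ℂ) * oddHurwitz k N (u * v : (ZMod N)ˣ) = 0 := by
  obtain ⟨P, hP⟩ := exists_oddHurwitz_eq_aeval hk hodd N
  -- Raising the root of unity to the power `b` multiplies every residue class by `b`.
  have key (b : ℕ) : aeval ((stdAddChar (1 : ZMod N) : ℂ) ^ b)
      (∑ u, C (c u) * P.comp (X ^ (u : ZMod N).val)) * I =
      ∑ u : (ZMod N)ˣ, (c u : ℂ) * oddHurwitz k N ((u : ZMod N) * (b : ZMod N)) := by
    rw [map_sum, Finset.sum_mul]
    refine Finset.sum_congr rfl fun u _ ↦ ?_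
    have : (stdAddChar ((u : ZMod N) * (b : ZMod N)) : ℂ) =
        ((stdAddChar (1 : ZMod N) : ℂ) ^ b) ^ (u : ZMod N).val := by
      rw [← pow_mul, ← AddChar.map_nsmul_eq_pow, nsmul_eq_mul, mul_one, Nat.cast_mul,
        natCast_zmod_val, mul_comm]
    rw [hP, this, map_mul, aeval_C, aeval_comp, map_pow, aeval_X, eq_ratCast]
    ring
  have h0 := key 1
  simp only [pow_one, Nat.cast_one, mul_one, h, mul_eq_zero, I_ne_zero, or_false] at h0
  have h1 := (isPrimitiveRoot_stdAddChar_one N).aeval_pow_eq_zero (NeZero.pos N)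
    (ZMod.val_coe_unit_coprime v) h0
  have h2 := key (v : ZMod N).val
  rw [h1, zero_mul, natCast_zmod_val] at h2
  simpa using h2.symm

/-- The only rational relations between the odd parts are those coming from oddness. -/
lemma even_of_sum_mul_oddHurwitz_eq_zero {k : ℕ} (hk : 1 < k) (hodd : Odd k) {N : ℕ} [NeZero N]
    {c : (ZMod N)ˣ → ℚ} (h : ∑ u, (c u : ℂ) * oddHurwitz k N u = 0) (v : (ZMod N)ˣ) :
    c v = c (-v) := by
  suffices hd : (fun u ↦ (c u : ℂ) - c (-u)) = 0 by
    have := congrFun hd v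
    simp only [Pi.zero_apply, sub_eq_zero] at this
    exact_mod_cast this
  refine eq_zero_of_forall_sum_char_eq_zero fun χ ↦ ?_
  have hneg : ∑ u, (c (-u) : ℂ) * χ (u⁻¹ : (ZMod N)ˣ) =
      χ (-1) * ∑ u, (c u : ℂ) * χ (u⁻¹ : (ZMod N)ˣ) := by
    rw [← Equiv.sum_comp (Equiv.neg (ZMod N)ˣ), Finset.mul_sum]
    refine Finset.sum_congr rfl fun u _ ↦ ?_
    rw [Equiv.neg_apply, neg_neg, show (-u)⁻¹ = -u⁻¹ from inv_eq_of_mul_eq_one_left (by simp),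
      Units.val_neg, ← neg_one_mul, map_mul]
    ring
  simp only [sub_mul, Finset.sum_sub_distrib]
  rw [hneg]
  rcases χ.even_or_odd with hχ | hχ
  · rw [hχ, one_mul, sub_self]
  suffices ∑ u, (c u : ℂ) * χ (u⁻¹ : (ZMod N)ˣ) = 0 by rw [this, mul_zero, sub_zero]
  -- The product of the two character sums is the `χ`-weighted sum of the translated relations,
  -- after the substitution `v ↦ u * v`.
  refine (mul_eq_zero.mp ?_).resolve_right (sum_char_mul_oddHurwitz_ne_zero hk hχ)
  have h1 : ∑ v : (ZMod N)ˣ, χ v * ∑ u, (c u : ℂ) * oddHurwitz k N (u * v : (ZMod N)ˣ) = 0 := by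
    simp only [sum_mul_oddHurwitz_mul_eq_zero hk hodd h, mul_zero, Finset.sum_const_zero]
  rw [← h1]
  simp only [Finset.mul_sum]
  rw [Finset.sum_comm (s := Finset.univ), ← Finset.mul_sum, Finset.sum_mul]
  refine Finset.sum_congr rfl fun u _ ↦ ?_
  rw [Finset.mul_sum, ← Equiv.sum_comp (Equiv.mulLeft u)]
  refine Finset.sum_congr rfl fun v _ ↦ ?_
  have h3 : χ (u⁻¹ : (ZMod N)ˣ) * χ ((u * v : (ZMod N)ˣ) : ZMod N) = χ v := by
    rw [← map_mul, ← Units.val_mul, inv_mul_cancel_left]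
  rw [Equiv.coe_mulLeft, ← h3]
  ring

/-- The units represented in `(0, N / 2)`, a system of representatives modulo sign. -/
abbrev HalfUnits (N : ℕ) : Type := {u : (ZMod N)ˣ // 2 * (u : ZMod N).val < N}

lemma two_mul_val_neg_lt_iff {N : ℕ} (hN : 2 < N) (u : (ZMod N)ˣ) :
    2 * ((-u : (ZMod N)ˣ) : ZMod N).val < N ↔ ¬ 2 * (u : ZMod N).val < N := by
  have : NeZero N := ⟨by omega⟩
  have : Fact (1 < N) := ⟨by omega⟩
  have hu : (u : ZMod N) ≠ 0 := u.ne_zero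
  have hval : ((-u : (ZMod N)ˣ) : ZMod N).val = N - (u : ZMod N).val := by
    rw [Units.val_neg, ZMod.neg_val, if_neg hu]
  have h1 := val_lt (u : ZMod N)
  -- A unit equal to `N / 2` would divide `N` while being coprime to it, forcing `N = 2`.
  have h2 : 2 * (u : ZMod N).val ≠ N := by
    intro h
    have hc := ZMod.val_coe_unit_coprime u
    have hd : (u : ZMod N).val ∣ N := ⟨2, by omega⟩
    have := Nat.Coprime.eq_one_of_dvd hc hd
    omega
  omega

lemma two_mul_card_halfUnits {N : ℕ} [NeZero N] (hN : 2 < N) :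
    2 * Fintype.card (HalfUnits N) = N.totient := by
  have h1 := Fintype.card_subtype_compl (fun u : (ZMod N)ˣ ↦ 2 * (u : ZMod N).val < N)
  have h2 : Fintype.card (HalfUnits N) =
      Fintype.card {u : (ZMod N)ˣ // ¬ 2 * (u : ZMod N).val < N} :=
    Fintype.card_congr ((Equiv.neg _).subtypeEquiv fun u ↦ by
      rw [Equiv.neg_apply, two_mul_val_neg_lt_iff hN, not_not])
  have h3 := Fintype.card_subtype_le (fun u : (ZMod N)ˣ ↦ 2 * (u : ZMod N).val < N)
  rw [ZMod.card_units_eq_totient] at h1 h3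
  unfold HalfUnits at *
  omega

lemma linearIndependent_oddHurwitz {k : ℕ} (hk : 1 < k) (hodd : Odd k) {N : ℕ} [NeZero N]
    (hN : 2 < N) : LinearIndependent ℚ (fun u : HalfUnits N ↦ oddHurwitz k N (u : (ZMod N)ˣ)) := by
  rw [Fintype.linearIndependent_iff]
  intro g hg u
  let c : (ZMod N)ˣ → ℚ := fun u ↦ if h : 2 * (u : ZMod N).val < N then g ⟨u, h⟩ else 0
  have hc : ∑ u, (c u : ℂ) * oddHurwitz k N u = 0 := by
    rw [← hg]
    symm
    refine Fintype.sum_of_injective _ Subtype.val_injective _ _ (fun b hb ↦ ?_) fun u ↦ ?_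
    · have : c b = 0 := dif_neg fun h ↦ hb ⟨⟨b, h⟩, rfl⟩
      simp [this]
    · have : c u = g u := dif_pos u.2
      rw [this, Rat.smul_def]
  have h1 := even_of_sum_mul_oddHurwitz_eq_zero hk hodd hc u
  have h2 : c u = g u := dif_pos u.2
  have h3 : c (-u) = 0 := dif_neg (by rw [two_mul_val_neg_lt_iff hN, not_not]; exact u.2)
  rw [← h2, h1, h3]

/-- The span of the normalized odd parts. -/
noncomputable def oddHurwitzSpace (k N : ℕ) [NeZero N] : Submodule ℚ ℂ :=
  Submodule.span ℚ (Set.range fun u : HalfUnits N ↦ oddHurwitz k N (u : (ZMod N)ˣ))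

lemma exists_aeval_of_mem_oddHurwitzSpace {k : ℕ} (hk : 1 < k) (hodd : Odd k) {N : ℕ} [NeZero N]
    {z : ℂ} (hz : z ∈ oddHurwitzSpace k N) :
    ∃ R : ℚ[X], z = I * aeval (stdAddChar (1 : ZMod N) : ℂ) R := by
  obtain ⟨P, hP⟩ := exists_oddHurwitz_eq_aeval hk hodd N
  induction hz using Submodule.span_induction with
  | mem x hx =>
    obtain ⟨u, rfl⟩ := hx
    refine ⟨P.comp (X ^ ((u : (ZMod N)ˣ) : ZMod N).val), ?_⟩
    rw [aeval_comp, map_pow, aeval_X, ← stdAddChar_eq_pow_val]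
    exact hP _
  | zero => exact ⟨0, by simp⟩
  | add x y _ _ hx hy =>
    obtain ⟨R, rfl⟩ := hx
    obtain ⟨S, rfl⟩ := hy
    exact ⟨R + S, by rw [map_add, mul_add]⟩
  | smul a x _ hx =>
    obtain ⟨R, rfl⟩ := hx
    exact ⟨a • R, by rw [_root_.map_smul, mul_smul_comm]⟩

/-! ### Cyclotomic fields of coprime conductors -/

lemma conj_aeval_rat (x : ℂ) (P : ℚ[X]) :
    (starRingEnd ℂ) (aeval x P) = aeval ((starRingEnd ℂ) x) P := by
  have := Polynomial.hom_eval₂ P (algebraMap ℚ ℂ) (starRingEnd ℂ) x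
  rw [aeval_def, aeval_def, this]
  congr 1
  exact Subsingleton.elim _ _

/-- An element of two cyclotomic fields of coprime conductors is real (indeed rational). -/
lemma conj_eq_self_of_aeval_eq_aeval {q r : ℕ} (hqr : q.Coprime r) (hq : 0 < q) (hr : 0 < r)
    {x y : ℂ} (hx : IsPrimitiveRoot x q) (hy : IsPrimitiveRoot y r) {P R : ℚ[X]}
    (h : aeval x P = aeval y R) : (starRingEnd ℂ) (aeval x P) = aeval x P := by
  have hxy : IsPrimitiveRoot (x * y) (q * r) := by
    rw [IsPrimitiveRoot.iff_orderOf, (Commute.all x y).orderOf_mul_eq_mul_orderOf_of_coprime,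
      ← hx.eq_orderOf, ← hy.eq_orderOf]
    rwa [← hx.eq_orderOf, ← hy.eq_orderOf]
  have hxpow {m n : ℕ} (h : m ≡ n [MOD q]) : x ^ m = x ^ n := by
    rw [← pow_mod_orderOf x m, ← pow_mod_orderOf x n, ← hx.eq_orderOf, h]
  have hypow {m n : ℕ} (h : m ≡ n [MOD r]) : y ^ m = y ^ n := by
    rw [← pow_mod_orderOf y m, ← pow_mod_orderOf y n, ← hy.eq_orderOf, h]
  -- The exponents `m` and `n` recover `x` and `y` from `x * y`; the exponent `b` conjugates `x` and
  -- fixes `y`.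
  obtain ⟨m, hmq, hmr⟩ := Nat.chineseRemainder hqr 1 0
  obtain ⟨n, hnq, hnr⟩ := Nat.chineseRemainder hqr 0 1
  obtain ⟨b, hbq, hbr⟩ := Nat.chineseRemainder hqr (q - 1) 1
  have hm : (x * y) ^ m = x := by
    rw [mul_pow, hxpow hmq, hypow hmr, pow_one, pow_zero, mul_one]
  have hn : (x * y) ^ n = y := by
    rw [mul_pow, hxpow hnq, hypow hnr, pow_one, pow_zero, one_mul]
  have hb : b.Coprime (q * r) := by
    refine Nat.Coprime.mul_right ?_ ?_
    · rw [Nat.Coprime, hbq.gcd_eq]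
      exact (Nat.coprime_self_sub_left (by omega : 1 ≤ q)).mpr (Nat.coprime_one_left q)
    · rw [Nat.Coprime, hbr.gcd_eq, Nat.gcd_one_left]
  have h1 := hxy.aeval_pow_eq_zero (P := P.comp (X ^ m) - R.comp (X ^ n)) (by positivity) hb
    (by rw [map_sub, aeval_comp, aeval_comp, map_pow, map_pow, aeval_X, hm, hn, h, sub_self])
  have hxb : x ^ b = (starRingEnd ℂ) x := by
    rw [hxpow hbq, ← Complex.inv_eq_conj (hx.norm'_eq_one hq.ne')]
    refine eq_inv_of_mul_eq_one_left ?_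
    rw [← pow_succ, Nat.sub_add_cancel hq, hx.pow_eq_one]
  have hyb : y ^ b = y := by rw [hypow hbr, pow_one]
  rw [map_sub, aeval_comp, aeval_comp, map_pow, map_pow, aeval_X, ← pow_mul, ← pow_mul,
    mul_comm b m, mul_comm b n, pow_mul, pow_mul, hm, hn, hxb, hyb, sub_eq_zero] at h1
  rw [conj_aeval_rat, h1, h]

lemma riemannZeta_natCast_conj {k : ℕ} (hk : 1 < k) :
    (starRingEnd ℂ) (riemannZeta k) = riemannZeta k := by
  rw [zeta_nat_eq_tsum_of_gt_one hk, Complex.conj_tsum]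
  simp

lemma not_mem_oddHurwitzSpace_of_coprime {k : ℕ} (hk : 1 < k) (hodd : Odd k) {q r : ℕ} [NeZero q]
    [NeZero r] (hqr : q.Coprime r)
    (hr : riemannZeta k / (Real.pi : ℂ) ^ k ∈ oddHurwitzSpace k r) :
    riemannZeta k / (Real.pi : ℂ) ^ k ∉ oddHurwitzSpace k q := by
  intro hq
  obtain ⟨P, hP⟩ := exists_aeval_of_mem_oddHurwitzSpace hk hodd hq
  obtain ⟨R, hR⟩ := exists_aeval_of_mem_oddHurwitzSpace hk hodd hr
  have h1 := conj_eq_self_of_aeval_eq_aeval hqr (NeZero.pos q) (NeZero.pos r)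
    (isPrimitiveRoot_stdAddChar_one q) (isPrimitiveRoot_stdAddChar_one r)
    (mul_left_cancel₀ I_ne_zero (hP.symm.trans hR))
  have h2 := congrArg (starRingEnd ℂ) hP
  rw [map_mul, h1, conj_I, neg_mul, ← hP, map_div₀, riemannZeta_natCast_conj hk, map_pow,
    conj_ofReal, self_eq_neg, div_eq_zero_iff] at h2
  rcases h2 with h2 | h2
  · exact riemannZeta_ne_zero_of_one_lt_re (by simpa using hk) h2
  · exact pow_ne_zero _ (by exact_mod_cast Real.pi_ne_zero) h2

/-! ### Dimension count -/

lemma hurwitzZeta_unit_mem {k N : ℕ} [NeZero N] (hN : 2 < N) (u : (ZMod N)ˣ) :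
    hurwitzZeta (toAddCircle (u : ZMod N)) k / (Real.pi : ℂ) ^ k ∈ normalizedHurwitzSpace k N := by
  have : Fact (1 < N) := ⟨by omega⟩
  refine Submodule.subset_span ⟨(u : ZMod N).val, ?_, val_lt _, ZMod.val_coe_unit_coprime u, ?_⟩
  · have := (ZMod.val_ne_zero (u : ZMod N)).mpr u.ne_zero
    omega
  · rw [toAddCircle_apply]

lemma oddHurwitz_mem {k N : ℕ} [NeZero N] (hN : 2 < N) (u : (ZMod N)ˣ) :
    oddHurwitz k N u ∈ normalizedHurwitzSpace k N := by
  rw [oddHurwitz, sub_div]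
  exact sub_mem (hurwitzZeta_unit_mem hN u) (hurwitzZeta_unit_mem hN (-u))

/-- Summing over all units gives `N ^ k ∏ (1 - p ^ (-k)) ζ(k)` over the primes `p ∣ N`, a nonzero
rational multiple of `ζ(k)`. -/
lemma riemannZeta_mem {k N : ℕ} [NeZero N] (hk : 1 < k) (hN : 2 < N) :
    riemannZeta k / (Real.pi : ℂ) ^ k ∈ normalizedHurwitzSpace k N := by
  have hk1 : (k : ℂ) ≠ 1 := by norm_cast; omega
  have h1 := DirichletCharacter.sum_units_mul_hurwitzZeta (1 : DirichletCharacter ℂ N) k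
  have h2 := DirichletCharacter.LFunctionTrivChar_eq_mul_riemannZeta (N := N) hk1
  rw [DirichletCharacter.LFunctionTrivChar] at h2
  simp only [h2, MulChar.one_apply_coe, one_mul] at h1
  let t : ℚ := (N : ℚ) ^ k * ∏ p ∈ N.primeFactors, (1 - ((p : ℚ) ^ k)⁻¹)
  have ht : (t : ℂ) = (N : ℂ) ^ (k : ℂ) * ∏ p ∈ N.primeFactors, (1 - (p : ℂ) ^ (-(k : ℂ))) := by
    simp [t, cpow_neg]
  have ht0 : t ≠ 0 := by
    refine mul_ne_zero (pow_ne_zero _ (NeZero.ne _)) (Finset.prod_ne_zero_iff.mpr fun p hp ↦ ?_)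
    have hp2 : 1 < (p : ℚ) := by exact_mod_cast (Nat.prime_of_mem_primeFactors hp).one_lt
    have := inv_lt_one_of_one_lt₀ (one_lt_pow₀ hp2 (by omega : k ≠ 0))
    exact (sub_pos.mpr this).ne'
  rw [← mul_assoc, ← ht] at h1
  have h3 : riemannZeta k / (Real.pi : ℂ) ^ k = t⁻¹ • ∑ u : (ZMod N)ˣ,
      hurwitzZeta (toAddCircle (u : ZMod N)) k / (Real.pi : ℂ) ^ k := by
    have : (t : ℂ) ≠ 0 := by exact_mod_cast ht0
    rw [← Finset.sum_div, h1, Rat.smul_def]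
    push_cast
    field_simp
  rw [h3]
  exact Submodule.smul_mem _ _ (Submodule.sum_mem _ fun u _ ↦ hurwitzZeta_unit_mem hN u)

lemma finite_normalizedHurwitzSpace (k q : ℕ) : Module.Finite ℚ (normalizedHurwitzSpace k q) := by
  refine FiniteDimensional.span_of_finite ℚ (((Set.finite_lt_nat q).image fun a : ℕ ↦
    hurwitzZeta (((a : ℝ) / (q : ℝ) : ℝ) : UnitAddCircle) (k : ℂ) / (Real.pi : ℂ) ^ k).subset ?_)
  rintro z ⟨a, -, ha, -, rfl⟩
  exact ⟨a, ha, rfl⟩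

lemma totient_div_two_add_one_le_finrank {k : ℕ} (hk : 1 < k) (hodd : Odd k) {q : ℕ} [NeZero q]
    (hq : 2 < q) (h : riemannZeta k / (Real.pi : ℂ) ^ k ∉ oddHurwitzSpace k q) :
    (Nat.totient q : ℚ) / 2 + 1 ≤ (Module.finrank ℚ (normalizedHurwitzSpace k q) : ℚ) := by
  have := finite_normalizedHurwitzSpace k q
  have hli := (linearIndependent_oddHurwitz hk hodd hq).option h
  have hmem : ∀ o : Option (HalfUnits q), (o.casesOn' (riemannZeta k / (Real.pi : ℂ) ^ k)
      (fun u : HalfUnits q ↦ oddHurwitz k q (u : (ZMod q)ˣ)) : ℂ) ∈ normalizedHurwitzSpace k q := by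
    rintro (_ | u)
    · exact riemannZeta_mem hk hq
    · exact oddHurwitz_mem hq u
  have hli' : LinearIndependent ℚ (fun o ↦ (⟨_, hmem o⟩ : normalizedHurwitzSpace k q)) :=
    LinearIndependent.of_comp (normalizedHurwitzSpace k q).subtype hli
  have h1 := hli'.fintype_card_le_finrank
  rw [Fintype.card_option] at h1
  have h2 : (2 * Fintype.card (HalfUnits q) : ℚ) = q.totient := by
    exact_mod_cast two_mul_card_halfUnits hq
  have h3 : (Fintype.card (HalfUnits q) + 1 : ℚ) ≤
      Module.finrank ℚ (normalizedHurwitzSpace k q) := by exact_mod_cast h1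
  linarith

theorem theorem5p5 (k : ℕ) (hk : 1 < k) (hodd : Odd k) :
    ∃ q₀ : ℕ, 2 < q₀ ∧ ∀ q : ℕ, 2 < q → Nat.Coprime q q₀ →
      (Nat.totient q : ℚ) / 2 + 1 ≤ (Module.finrank ℚ (normalizedHurwitzSpace k q) : ℚ) := by
  by_cases h : ∃ r : ℕ, ∃ _ : NeZero r, 2 < r ∧
      riemannZeta k / (Real.pi : ℂ) ^ k ∈ oddHurwitzSpace k r
  · obtain ⟨r, _, hr, hmem⟩ := h
    refine ⟨r, hr, fun q hq hqr ↦ ?_⟩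
    have : NeZero q := ⟨by omega⟩
    exact totient_div_two_add_one_le_finrank hk hodd hq
      (not_mem_oddHurwitzSpace_of_coprime hk hodd hqr hmem)
  · push Not at h
    -- With no exceptional modulus the bound holds for all `q > 2`, so any value above 2 would do.
    refine ⟨3, by norm_num, fun q hq _ ↦ ?_⟩
    have : NeZero q := ⟨by omega⟩
    exact totient_div_two_add_one_le_finrank hk hodd hq (h q this hq)
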